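/- Let $\Phi:\mathbb R\to\mathbb R$ be a symmetric (even) $C^2$ convex function satisfying (**H**) there exist $M>0$ and $0<\varepsilon\le 1/2$ such that $\Phi(M)>0$ and, for all $x\ge M$, $$(1+\varepsilon)\Phi(x)\le x\,\Phi'(x)\le(2-\varepsilon)\Phi(x).$$ Let $\mu_\Phi(dx)=Z_\Phi^{-1}e^{-\Phi(x)}\,dx$ with $Z_\Phi=\int_{\mathbb R} e^{-\Phi(x)}\,dx$ (finite under (**H**)), and let $\Phi^*(x)=\sup_{y\in\mathbb R}\{xy-\Phi(y)\}$ be the Legendre–Fenchel transform of $\Phi$. Then there exist constants $A,A',B,D,\kappa\ge0$, depending only on $\Phi$, such that for every locally absolutely continuous function $f:\mathbb R\to[0,\infty)$ with $\int f^2\,d\mu_\Phi=1$, $$\mathrm{Ent}_{\mu_\Phi}(f^2)\le A\,\mathrm{Var}_{\mu_\Phi}(f)+A'\int_{\{f^2\ge\kappa\}}H_\Phi\!\left(\frac{f'}{f}\right)f^2\,d\mu_\Phi,$$ where $$H_\Phi(x)=\begin{cases}\Phi^*(Bx)&\text{if }|x|>D,\\ x^2&\text{if }|x|\le D,\end{cases}$$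 $\mathrm{Ent}_{\mu}(g)=\int g\log g\,d\mu-\int g\,d\mu\,\log\int g\,d\mu$ (with $0\log0=0$) and $\mathrm{Var}_\mu(f)=\int f^2\,d\mu-\left(\int f\,d\mu\right)^2$. The integrand on the right is taken to be $0$ where $f=0$. When the integral on the right is $+\infty$ nothing is claimed; when it is finite, the inequality includes the assertion that $f^2\log f^2$ is $\mu_\Phi$-integrable, i.e. that the entropy is finite. -/

import Mathlib

open MeasureTheory ProbabilityTheory Set

noncomputable section

/-- Growth hypothesis (H): for some `M > 0` with `Φ M > 0` and some `ε ∈ (0, 1/2]`,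
`(1 + ε) Φ(x) ≤ x Φ'(x) ≤ (2 - ε) Φ(x)` for all `x ≥ M`. -/
def GrowthHyp (Φ : ℝ → ℝ) : Prop :=
  ∃ M ε : ℝ, 0 < M ∧ 0 < ε ∧ ε ≤ 1 / 2 ∧ 0 < Φ M ∧
    ∀ x, M ≤ x → (1 + ε) * Φ x ≤ x * deriv Φ x ∧ x * deriv Φ x ≤ (2 - ε) * Φ x

/-- The measure `μ_Φ(dx) = exp(-Φ(x)) dx / Z_Φ` on `ℝ`, where `Z_Φ = ∫ exp(-Φ(x)) dx`. -/
def muPhi (Φ : ℝ → ℝ) : Measure ℝ :=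
  (volume : Measure ℝ).tilted (fun x => -Φ x)

/-- The Legendre-Fenchel transform `Φ*(x) = sup_y (x y - Φ(y))`.
Under (H) for an even continuous `Φ`, the supremum is finite: see `bddAbove_legendre`. -/
def legendre (Φ : ℝ → ℝ) (x : ℝ) : ℝ :=
  ⨆ y : ℝ, (x * y - Φ y)

/-- `H_Φ(x) = Φ*(B x)` if `|x| > D` and `H_Φ(x) = x²` if `|x| ≤ D`. -/
def modH (Φ : ℝ → ℝ) (B D x : ℝ) : ℝ :=
  open Classical in if D < |x| then legendre Φ (B * x) else x ^ 2

/-- The entropy `Ent_μ(g) = ∫ g log g dμ - (∫ g dμ) log (∫ g dμ)`, with `0 log 0 = 0`. -/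
def ent (μ : Measure ℝ) (g : ℝ → ℝ) : ℝ :=
  ∫ x, g x * Real.log (g x) ∂μ - (∫ x, g x ∂μ) * Real.log (∫ x, g x ∂μ)

/-- `f` is absolutely continuous on every compact interval of `ℝ`. -/
def LocallyAbsolutelyContinuous (f : ℝ → ℝ) : Prop :=
  ∀ a b : ℝ, AbsolutelyContinuousOnInterval f a b

/-- Under (H), `Φ` grows at least like a power with exponent larger than `1`. -/
theorem GrowthHyp.superlinear {Φ : ℝ → ℝ} (hd : Differentiable ℝ Φ) (hH : GrowthHyp Φ) :
    ∃ M ε c : ℝ, 0 < M ∧ 0 < ε ∧ 0 < c ∧ ∀ x, M ≤ x → c * x ^ (1 + ε) ≤ Φ x := by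
  obtain ⟨M, ε, hM, hε, -, hΦM, h⟩ := hH
  have key : MonotoneOn (fun x => Φ x * x ^ (-(1 + ε))) (Ici M) := by
    have hder : ∀ x, 0 < x → HasDerivAt (fun x => Φ x * x ^ (-(1 + ε)))
        (deriv Φ x * x ^ (-(1 + ε)) + Φ x * (-(1 + ε) * x ^ (-(1 + ε) - 1))) x := fun x hx =>
      (hd x).hasDerivAt.mul (Real.hasDerivAt_rpow_const (Or.inl hx.ne'))
    apply monotoneOn_of_deriv_nonneg (convex_Ici M)
    · intro x hx
      exact (hder x (hM.trans_le hx)).continuousAt.continuousWithinAt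
    · intro x hx
      rw [interior_Ici] at hx
      exact (hder x (hM.trans hx)).differentiableAt.differentiableWithinAt
    · intro x hx
      rw [interior_Ici] at hx
      have hx0 : 0 < x := hM.trans hx
      rw [(hder x hx0).deriv]
      have e : x ^ (-(1 + ε)) = x * x ^ (-(1 + ε) - 1) := by
        rw [Real.rpow_sub_one hx0.ne']; field_simp
      rw [e]
      have h1 := (h x (le_of_lt hx)).1
      have h2 : 0 ≤ x ^ (-(1 + ε) - 1) := Real.rpow_nonneg hx0.le _
      nlinarith [mul_nonneg (sub_nonneg.2 h1) h2]
  refine ⟨M, ε, Φ M * M ^ (-(1 + ε)), hM, hε, by positivity, fun x hx => ?_⟩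
  have hx0 : 0 < x := hM.trans_le hx
  have h3 := key (mem_Ici.2 le_rfl) (mem_Ici.2 hx) hx
  have h4 : Φ x * x ^ (-(1 + ε)) * x ^ (1 + ε) = Φ x := by
    rw [mul_assoc, ← Real.rpow_add hx0]; simp
  rw [← h4]
  exact mul_le_mul_of_nonneg_right h3 (Real.rpow_nonneg hx0.le _)

/-- Under (H), the supremum that defines `legendre Φ x` is finite. -/
theorem bddAbove_legendre {Φ : ℝ → ℝ} (hd : Differentiable ℝ Φ) (he : ∀ x, Φ (-x) = Φ x)
    (hH : GrowthHyp Φ) (x : ℝ) : BddAbove (range fun y : ℝ => x * y - Φ y) := by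
  obtain ⟨M, ε, c, hM, hε, hc, h⟩ := hH.superlinear hd
  have hlim : Filter.Tendsto (fun y : ℝ => c * y ^ ε) Filter.atTop Filter.atTop :=
    (tendsto_rpow_atTop hε).const_mul_atTop hc
  obtain ⟨N, hN⟩ := Filter.eventually_atTop.1 (hlim.eventually_ge_atTop |x|)
  set R := max M N
  obtain ⟨K, hK⟩ := (isCompact_Icc (a := -R) (b := R)).bddAbove_image
    (f := fun y => x * y - Φ y) (by have := hd.continuous; fun_prop)
  refine ⟨max K 0, ?_⟩
  rintro _ ⟨y, rfl⟩
  by_cases hy : |y| ≤ R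
  · exact le_max_of_le_left (hK ⟨y, abs_le.1 hy, rfl⟩)
  · push Not at hy
    apply le_max_of_le_right
    have hMy : M ≤ |y| := (le_max_left _ _).trans hy.le
    have hNy : N ≤ |y| := (le_max_right _ _).trans hy.le
    have hy0 : 0 < |y| := hM.trans_le hMy
    have e1 : Φ |y| = Φ y := by
      rcases abs_choice y with h | h <;> rw [h]
      exact he y
    have e2 := h |y| hMy
    rw [e1, Real.rpow_add hy0, Real.rpow_one] at e2
    have e3 := mul_le_mul_of_nonneg_right (hN |y| hNy) hy0.le
    have e4 : x * y ≤ |x| * |y| := by rw [← abs_mul]; exact le_abs_self _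
    change x * y - Φ y ≤ 0
    nlinarith

/-- Under (H), `exp (-Φ)` is Lebesgue integrable and `μ_Φ` is a probability measure. -/
theorem isProbabilityMeasure_muPhi {Φ : ℝ → ℝ} (hd : Differentiable ℝ Φ)
    (he : ∀ x, Φ (-x) = Φ x) (hH : GrowthHyp Φ) : IsProbabilityMeasure (muPhi Φ) := by
  obtain ⟨K, hK⟩ := bddAbove_legendre hd he hH 1
  have hb : ∀ x : ℝ, |x| - Φ x ≤ K := fun x => by
    have e1 : Φ |x| = Φ x := by
      rcases abs_choice x with h | h <;> rw [h]
      exact he x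
    have := hK ⟨|x|, rfl⟩
    simpa [e1] using this
  have hint : Integrable fun x : ℝ => Real.exp (-|x|) := by
    have h1 : IntegrableOn (fun x : ℝ => Real.exp (-|x|)) (Ioi 0) :=
      (integrableOn_exp_neg_Ioi 0).congr_fun
        (fun x hx => by rw [abs_of_pos hx]) measurableSet_Ioi
    have h2 : IntegrableOn (fun x : ℝ => Real.exp (-|x|)) (Iic 0) :=
      (integrableOn_exp_Iic 0).congr_fun
        (fun x hx => by simp [abs_of_nonpos (mem_Iic.1 hx)]) measurableSet_Iic
    rw [← integrableOn_univ, ← Iic_union_Ioi (a := (0 : ℝ))]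
    exact h2.union h1
  have hint2 : Integrable fun x : ℝ => Real.exp (-Φ x) := by
    refine (hint.const_mul (Real.exp K)).mono' ?_ (Filter.Eventually.of_forall fun x => ?_)
    · have := hd.continuous
      exact (by fun_prop : Continuous fun x => Real.exp (-Φ x)).aestronglyMeasurable
    · rw [Real.norm_of_nonneg (Real.exp_pos _).le, ← Real.exp_add]
      exact Real.exp_le_exp.2 (by linarith [hb x])
  exact isProbabilityMeasure_tilted hint2

end

/-! Where `f < 2`, `f² log f²` is at most `f² - 1 + 5 (f - 1)²`; as `f² - 1` has mean zero, this
part costs only the variance.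

Where `f ≥ 2`, `f²` is comparable to `G = v² r ^ (m + 1)`, with `v = (f - 1)₊` and `r = v / (1 +
v)`. The derivative of `G exp (-Φ)` is integrable, so `G exp (-Φ) ≤ S` and `log G ≤ log S + Φ`
(`mul_exp_neg_le`). Since `Φ ≤ C + x Φ'`, everything reduces to the moment `∫ G x Φ' exp (-Φ)`.

Integration by parts bounds this moment by `∫ (x G)' exp (-Φ)`
(`integral_mul_deriv_mul_exp_neg_le`). With `a = f' / f`, `|x G'| ≤ v² (m + 3) r ^ m |a| |x|`, and
Young's inequality splits the product into `Φ*(B |a|)` and `Φ(r ^ m |x| / 2)`. By (H), `Φ(s x) ≤ s ^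
(1 + ε) Φ(x)` when `0 < s ≤ 1` and `s x ≥ M`; once `m ε ≥ 1` the second term is, up to a constant,
at most `r ^ (m + 1) x Φ' / 2`, so half of the moment is absorbed (`GrowthHyp.exists_young`). What
remains is linear in `∫ v² dμ ≤ 2 Var f` and in the energy over `{f ≥ 1}`. -/

/-! ### Growth and symmetry of the potential. -/

/-- If `p Φ(x) ≤ x Φ'(x)` on `[M, ∞)`, then `Φ(x) / x ^ p` is nondecreasing there. -/
theorem monotoneOn_mul_rpow_neg {Φ : ℝ → ℝ} (hd : Differentiable ℝ Φ) {M p : ℝ} (hM : 0 < M)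
    (h : ∀ x, M ≤ x → p * Φ x ≤ x * deriv Φ x) :
    MonotoneOn (fun x => Φ x * x ^ (-p)) (Ici M) := by
  have hder : ∀ x, 0 < x → HasDerivAt (fun x => Φ x * x ^ (-p))
      (deriv Φ x * x ^ (-p) + Φ x * (-p * x ^ (-p - 1))) x := fun x hx =>
    (hd x).hasDerivAt.mul (Real.hasDerivAt_rpow_const (Or.inl hx.ne'))
  apply monotoneOn_of_deriv_nonneg (convex_Ici M)
  · intro x hx
    exact (hder x (hM.trans_le hx)).continuousAt.continuousWithinAt
  · intro x hx
    rw [interior_Ici] at hx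
    exact (hder x (hM.trans hx)).differentiableAt.differentiableWithinAt
  · intro x hx
    rw [interior_Ici] at hx
    have hx0 : 0 < x := hM.trans hx
    rw [(hder x hx0).deriv]
    have e : x ^ (-p) = x * x ^ (-p - 1) := by
      rw [Real.rpow_sub_one hx0.ne']; field_simp
    rw [e]
    have h1 := h x (le_of_lt hx)
    have h2 : 0 ≤ x ^ (-p - 1) := Real.rpow_nonneg hx0.le _
    nlinarith [mul_nonneg (sub_nonneg.2 h1) h2]

theorem apply_mul_le_rpow_mul {Φ : ℝ → ℝ} (hd : Differentiable ℝ Φ) {M p : ℝ} (hM : 0 < M)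
    (h : ∀ x, M ≤ x → p * Φ x ≤ x * deriv Φ x) {s x : ℝ} (hs0 : 0 < s) (hs1 : s ≤ 1)
    (hx0 : 0 < x) (hsx : M ≤ s * x) : Φ (s * x) ≤ s ^ p * Φ x := by
  have hle : s * x ≤ x := by nlinarith
  have := monotoneOn_mul_rpow_neg hd hM h (mem_Ici.2 hsx) (mem_Ici.2 (hsx.trans hle)) hle
  simp only [Real.mul_rpow hs0.le hx0.le, Real.rpow_neg hs0.le, Real.rpow_neg hx0.le] at this
  have hs := Real.rpow_pos_of_pos hs0 p
  have hx := Real.rpow_pos_of_pos hx0 p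
  field_simp at this
  linarith

theorem even_apply_abs {Φ : ℝ → ℝ} (he : ∀ x, Φ (-x) = Φ x) (x : ℝ) : Φ |x| = Φ x := by
  rcases abs_choice x with h | h <;> rw [h]
  exact he x

theorem deriv_neg_of_even {Φ : ℝ → ℝ} (he : ∀ x, Φ (-x) = Φ x) (x : ℝ) :
    deriv Φ (-x) = -deriv Φ x := by
  have h := deriv_comp_neg Φ x
  simp only [he] at h
  linarith

theorem mul_deriv_abs_of_even {Φ : ℝ → ℝ} (he : ∀ x, Φ (-x) = Φ x) (x : ℝ) :
    |x| * deriv Φ |x| = x * deriv Φ x := by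
  rcases abs_choice x with h | h <;> rw [h]
  rw [deriv_neg_of_even he]; ring

theorem ConvexOn.mul_deriv_nonneg_of_even {Φ : ℝ → ℝ} (hc : ConvexOn ℝ univ Φ)
    (hd : Differentiable ℝ Φ) (he : ∀ x, Φ (-x) = Φ x) (x : ℝ) : 0 ≤ x * deriv Φ x := by
  have hm := hc.monotoneOn_deriv (fun y _ => hd y)
  have h0 : deriv Φ 0 = 0 := by
    have := deriv_neg_of_even he 0
    rw [neg_zero] at this; linarith
  rcases le_total 0 x with hx | hx
  · exact mul_nonneg hx (h0 ▸ hm (mem_univ _) (mem_univ _) hx)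
  · exact mul_nonneg_of_nonpos_of_nonpos hx (h0 ▸ hm (mem_univ _) (mem_univ _) hx)

/-! ### The Legendre transform and the Young-type inequality. -/

theorem le_legendre {Φ : ℝ → ℝ} (hd : Differentiable ℝ Φ) (he : ∀ x, Φ (-x) = Φ x)
    (hH : GrowthHyp Φ) (x y : ℝ) : x * y - Φ y ≤ legendre Φ x :=
  le_ciSup (bddAbove_legendre hd he hH x) y

theorem legendre_le_of_abs_le {Φ : ℝ → ℝ} (hd : Differentiable ℝ Φ) (he : ∀ x, Φ (-x) = Φ x)
    (hH : GrowthHyp Φ) {x z : ℝ} (hxz : |x| ≤ z) : legendre Φ x ≤ legendre Φ z := by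
  refine ciSup_le fun y => ?_
  have h1 := le_legendre hd he hH z |y|
  rw [even_apply_abs he] at h1
  have h2 : x * y ≤ |x| * |y| := by rw [← abs_mul]; exact le_abs_self _
  have h3 := mul_le_mul_of_nonneg_right hxz (abs_nonneg y)
  linarith

/-- For `B ≥ 2` and `D = |Φ 1|`, the modified cost dominates `|x| - 1`. -/
theorem abs_le_one_add_modH {Φ : ℝ → ℝ} (hd : Differentiable ℝ Φ) (he : ∀ x, Φ (-x) = Φ x)
    (hH : GrowthHyp Φ) {B : ℝ} (hB : 2 ≤ B) (x : ℝ) :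
    0 ≤ modH Φ B |Φ 1| x ∧ |x| ≤ 1 + modH Φ B |Φ 1| x := by
  unfold modH
  split_ifs with h
  -- Testing the supremum at `y = ±1` gives `Φ*(B x) ≥ 2 |x| - Φ 1`, and here `Φ 1 ≤ D < |x|`.
  · have key : |x| ≤ legendre Φ (B * x) := by
      have h0 := le_abs_self (Φ 1)
      have h2 := abs_nonneg x
      rcases abs_cases x with ⟨e, -⟩ | ⟨e, -⟩
      · have := le_legendre hd he hH (B * x) 1
        nlinarith
      · have := le_legendre hd he hH (B * x) (-1)
        rw [he] at this
        nlinarith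
    exact ⟨(abs_nonneg x).trans key, by linarith⟩
  · refine ⟨sq_nonneg x, ?_⟩
    rw [← sq_abs]
    nlinarith [sq_nonneg (|x| - 1), abs_nonneg x]

/-- Pointwise control of an even convex potential satisfying the growth hypothesis by `x Φ'(x)`,
together with the Young-type inequality between `modH` and the potential. -/
theorem GrowthHyp.exists_young {Φ : ℝ → ℝ} (hC : ContDiff ℝ 1 Φ) (hc : ConvexOn ℝ univ Φ)
    (he : ∀ x, Φ (-x) = Φ x) (hH : GrowthHyp Φ) :
    ∃ (m : ℕ) (C : ℝ), 0 ≤ C ∧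
      (∀ x, |Φ x| ≤ C + x * deriv Φ x) ∧ (∀ x, |deriv Φ x| ≤ C + x * deriv Φ x) ∧
      ∀ a x r : ℝ, 0 ≤ r → r ≤ 1 →
        (m + 3) * r ^ m * (|a| * |x|) ≤
          modH Φ (2 * (m + 3)) |Φ 1| a + C + r ^ (m + 1) * (x * deriv Φ x) / 2 := by
  have hd : Differentiable ℝ Φ := hC.differentiable (by norm_num)
  have hcd : Continuous (deriv Φ) := hC.continuous_deriv (by norm_num)
  have hP := hc.mul_deriv_nonneg_of_even hd he
  have hH' := hH
  obtain ⟨M, ε, hM, hε, -, hΦM, h⟩ := hH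
  -- This makes `m (1 + ε) ≥ m + 1`, the exponent needed for absorption.
  obtain ⟨m, hm⟩ := exists_nat_ge (1 / ε)
  obtain ⟨C₁, hC₁⟩ := isCompact_Icc.exists_bound_of_continuousOn (s := Icc (-M) M)
    hd.continuous.continuousOn
  obtain ⟨C₂, hC₂⟩ := isCompact_Icc.exists_bound_of_continuousOn (s := Icc (-1 : ℝ) 1)
    hcd.continuousOn
  have hC₁0 : 0 ≤ C₁ := (norm_nonneg _).trans (hC₁ 0 ⟨by linarith, hM.le⟩)
  have hC₂0 : 0 ≤ C₂ := (norm_nonneg _).trans (hC₂ 0 (by simp))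
  set B : ℝ := 2 * (m + 3) with hBdef
  have hB2 : 2 ≤ B := by rw [hBdef]; linarith [(Nat.cast_nonneg m : (0 : ℝ) ≤ m)]
  -- `L` pays for replacing `Φ*` by the square when `|a| ≤ |Φ 1|`.
  set L := |legendre Φ (B * |Φ 1|)| with hL
  have hL0 : 0 ≤ L := abs_nonneg _
  have hpos : ∀ x, M ≤ |x| → 0 ≤ Φ x := by
    intro x hx
    have hx0 := hM.trans_le hx
    have h1 := monotoneOn_mul_rpow_neg hd hM (fun y hy => (h y hy).1) (mem_Ici.2 le_rfl)
      (mem_Ici.2 hx) hx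
    have h2 : 0 ≤ Φ |x| * |x| ^ (-(1 + ε)) := le_trans (by positivity) h1
    rw [even_apply_abs he] at h2
    exact nonneg_of_mul_nonneg_left h2 (by positivity)
  have hle : ∀ x, M ≤ |x| → Φ x ≤ x * deriv Φ x := by
    intro x hx
    have h1 := (h |x| hx).1
    rw [even_apply_abs he, mul_deriv_abs_of_even he] at h1
    nlinarith [hpos x hx]
  have hsmall : ∀ x, |x| ≤ M → |Φ x| ≤ C₁ := fun x hx => hC₁ x (abs_le.1 hx)
  refine ⟨m, C₁ + C₂ + L, by positivity, fun x => ?_, fun x => ?_, fun a x r hr0 hr1 => ?_⟩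
  · rcases le_total |x| M with hx | hx
    · linarith [hsmall x hx, hP x]
    · rw [abs_of_nonneg (hpos x hx)]
      linarith [hle x hx]
  · rcases le_total |x| 1 with hx | hx
    · have := hC₂ x (abs_le.1 hx)
      rw [Real.norm_eq_abs] at this
      linarith [hP x]
    · have : |deriv Φ x| ≤ x * deriv Φ x := by
        rw [← abs_of_nonneg (hP x), abs_mul]
        nlinarith [abs_nonneg (deriv Φ x)]
      linarith
  · have hleg : legendre Φ (B * |a|) ≤ modH Φ B |Φ 1| a + L := by
      have hmod := (abs_le_one_add_modH hd he hH' hB2 a).1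
      have heven : legendre Φ (B * |a|) ≤ legendre Φ (B * a) := by
        refine ciSup_le fun y => ?_
        rcases abs_choice a with e | e <;> rw [e]
        · exact le_legendre hd he hH' _ y
        · have := le_legendre hd he hH' (B * a) (-y)
          rw [he] at this
          linarith
      by_cases hD : |Φ 1| < |a|
      · rw [modH, if_pos hD]; linarith
      · have h1 : legendre Φ (B * |a|) ≤ legendre Φ (B * |Φ 1|) :=
          legendre_le_of_abs_le hd he hH' (by
            rw [abs_mul, abs_abs, abs_of_nonneg (by linarith : 0 ≤ B)]
            exact mul_le_mul_of_nonneg_left (not_lt.1 hD) (by linarith))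
        linarith [le_abs_self (legendre Φ (B * |Φ 1|))]
    have hΦs : Φ (r ^ m / 2 * |x|) ≤ C₁ + r ^ (m + 1) * (x * deriv Φ x) / 2 := by
      have hrP : 0 ≤ r ^ (m + 1) * (x * deriv Φ x) / 2 := by have := hP x; positivity
      rcases le_total (r ^ m / 2 * |x|) M with hx | hx
      · have := hsmall (r ^ m / 2 * |x|) (by rwa [abs_of_nonneg (by positivity)])
        linarith [le_abs_self (Φ (r ^ m / 2 * |x|))]
      · have hprod : 0 < r ^ m / 2 * |x| := hM.trans_le hx
        have hs0 : 0 < r ^ m / 2 := pos_of_mul_pos_left hprod (abs_nonneg x)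
        have hx0 : 0 < |x| := pos_of_mul_pos_right hprod hs0.le
        have hs1 : r ^ m / 2 ≤ 1 := by linarith [pow_le_one₀ hr0 hr1 (n := m)]
        have hMx : M ≤ |x| := hx.trans (by nlinarith)
        have h1 := apply_mul_le_rpow_mul hd hM (fun y hy => (h y hy).1) hs0 hs1 hx0 hx
        rw [even_apply_abs he] at h1
        -- The factor `1 / 2` that permits absorption comes from `2 ^ (1 + ε) ≥ 2`.
        have h2 : (r ^ m / 2) ^ (1 + ε) ≤ r ^ (m + 1) / 2 := by
          rw [Real.div_rpow (by positivity) (by norm_num)]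
          have h3 : (r ^ m) ^ (1 + ε) ≤ r ^ (m + 1) := by
            rcases hr0.eq_or_lt with h0 | h0
            · rw [← h0] at hs0
              rcases m with _ | m
              · have : 1 / ε ≤ 0 := by simpa using hm
                exact absurd this (not_le.2 (by positivity))
              · simp at hs0
            · rw [← Real.rpow_natCast r m, ← Real.rpow_mul hr0, ← Real.rpow_natCast r (m + 1)]
              apply Real.rpow_le_rpow_of_exponent_ge h0 hr1
              rw [div_le_iff₀ hε] at hm
              push_cast; linarith
          have h4 : (2 : ℝ) ≤ 2 ^ (1 + ε) := by
            conv_lhs => rw [← Real.rpow_one 2]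
            exact Real.rpow_le_rpow_of_exponent_le (by norm_num) (by linarith)
          exact div_le_div₀ (by positivity) h3 (by norm_num) h4
        have h5 := mul_le_mul h2 (hle x hMx) (hpos x hMx) (by positivity)
        linarith
    -- Young's inequality at `(B |a|, r ^ m |x| / 2)`; `B = 2 (m + 3)` makes the product exactly the
    -- left-hand side.
    have hy := le_legendre hd he hH' (B * |a|) (r ^ m / 2 * |x|)
    have e : B * |a| * (r ^ m / 2 * |x|) = (m + 3) * r ^ m * (|a| * |x|) := by
      rw [hBdef]; ring
    rw [e] at hy
    linarith

/-! ### Locally absolutely continuous functions. -/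

namespace LocallyAbsolutelyContinuous

theorem continuous {f : ℝ → ℝ} (hf : LocallyAbsolutelyContinuous f) : Continuous f := by
  rw [continuous_iff_continuousAt]
  intro x
  refine (hf (x - 1) (x + 1)).continuousOn.continuousAt ?_
  rw [uIcc_of_le (by linarith)]
  exact Icc_mem_nhds (by linarith) (by linarith)

theorem ae_differentiableAt {f : ℝ → ℝ} (hf : LocallyAbsolutelyContinuous f) :
    ∀ᵐ x, DifferentiableAt ℝ f x := by
  have h : ∀ n : ℕ, ∀ᵐ x, x ∈ uIcc (-(n : ℝ)) n → DifferentiableAt ℝ f x := fun n =>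
    (hf _ _).ae_differentiableAt
  filter_upwards [ae_all_iff.2 h] with x hx
  obtain ⟨n, hn⟩ := exists_nat_ge |x|
  refine hx n ?_
  rw [uIcc_of_le (by linarith [abs_nonneg x])]
  exact abs_le.1 hn

theorem mul {f g : ℝ → ℝ} (hf : LocallyAbsolutelyContinuous f)
    (hg : LocallyAbsolutelyContinuous g) : LocallyAbsolutelyContinuous fun x => f x * g x :=
  fun a b => (hf a b).fun_mul (hg a b)

theorem const (c : ℝ) : LocallyAbsolutelyContinuous fun _ => c := fun _ _ =>
  (LipschitzWith.const c).lipschitzOnWith.absolutelyContinuousOnInterval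

theorem pow {f : ℝ → ℝ} (hf : LocallyAbsolutelyContinuous f) (n : ℕ) :
    LocallyAbsolutelyContinuous fun x => f x ^ n := by
  induction n with
  | zero => simpa using const 1
  | succ n ih => simpa only [pow_succ] using ih.mul hf

theorem of_contDiff {f : ℝ → ℝ} (hf : ContDiff ℝ 1 f) : LocallyAbsolutelyContinuous f := by
  intro a b
  obtain ⟨K, hK⟩ := hf.contDiffOn.exists_lipschitzOnWith (n := 1) (s := uIcc a b)
    one_ne_zero (convex_uIcc a b) isCompact_uIcc
  exact hK.absolutelyContinuousOnInterval

theorem of_dist_le {f g : ℝ → ℝ} (hf : LocallyAbsolutelyContinuous f)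
    (h : ∀ x y, dist (g x) (g y) ≤ dist (f x) (f y)) : LocallyAbsolutelyContinuous g :=
  fun a b => squeeze_zero (fun _ => Finset.sum_nonneg fun _ _ => dist_nonneg)
    (fun _ => Finset.sum_le_sum fun _ _ => h _ _) (hf a b)

end LocallyAbsolutelyContinuous

/-! ### The truncated square and its derivative. -/

/-- The excess `(t - 1)₊`. -/
noncomputable def excess (t : ℝ) : ℝ := max (t - 1) 0

/-- The ratio `v / (1 + v)` with `v = (t - 1)₊`. -/
noncomputable def excessRatio (t : ℝ) : ℝ := excess t / (1 + excess t)

/-- A smooth truncation of `t ^ 2`, vanishing to order `m + 3` at `t = 1`. -/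
noncomputable def cutoffSq (m : ℕ) (t : ℝ) : ℝ := excess t ^ 2 * excessRatio t ^ (m + 1)

theorem excess_nonneg (t : ℝ) : 0 ≤ excess t := le_max_right _ _

theorem excess_of_le {t : ℝ} (h : t ≤ 1) : excess t = 0 := max_eq_right (by linarith)

theorem excess_of_one_le {t : ℝ} (h : 1 ≤ t) : excess t = t - 1 := max_eq_left (by linarith)

theorem excessRatio_nonneg (t : ℝ) : 0 ≤ excessRatio t :=
  div_nonneg (excess_nonneg t) (by linarith [excess_nonneg t])

theorem excessRatio_le_one (t : ℝ) : excessRatio t ≤ 1 :=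
  div_le_one_of_le₀ (by linarith) (by linarith [excess_nonneg t])

theorem cutoffSq_nonneg (m : ℕ) (t : ℝ) : 0 ≤ cutoffSq m t :=
  mul_nonneg (sq_nonneg _) (pow_nonneg (excessRatio_nonneg t) _)

theorem cutoffSq_le (m : ℕ) (t : ℝ) : cutoffSq m t ≤ excess t ^ 2 :=
  mul_le_of_le_one_right (sq_nonneg _) (pow_le_one₀ (excessRatio_nonneg t) (excessRatio_le_one t))

/-- For `t ≥ 2` both `excess t ≥ t / 2` and `excessRatio t ≥ 1 / 2`, which costs `2 ^ 2 * 2 ^ (m +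
1)`. -/
theorem sq_le_mul_cutoffSq (m : ℕ) {t : ℝ} (ht : 2 ≤ t) :
    t ^ 2 ≤ 2 ^ (m + 3) * cutoffSq m t := by
  have hv : excess t = t - 1 := excess_of_one_le (by linarith)
  have hr : 1 / 2 ≤ excessRatio t := by
    rw [excessRatio, hv, div_le_div_iff₀ (by norm_num) (by linarith)]; linarith
  have h1 : (1 / 2 : ℝ) ^ (m + 1) ≤ excessRatio t ^ (m + 1) :=
    pow_le_pow_left₀ (by norm_num) hr _
  have h2 : (t / 2) ^ 2 ≤ excess t ^ 2 := by
    rw [hv]; exact pow_le_pow_left₀ (by linarith) (by linarith) _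
  have h3 := mul_le_mul h2 h1 (by positivity) (sq_nonneg _)
  calc t ^ 2 = 2 ^ (m + 3) * ((t / 2) ^ 2 * (1 / 2) ^ (m + 1)) := by
        rw [div_pow, one_div, inv_pow, pow_add 2 (m + 1) 2]; field_simp
    _ ≤ _ := mul_le_mul_of_nonneg_left h3 (by positivity)

/-- Both `t ↦ (t - 1)₊` and `v ↦ v / (1 + v)` on `v ≥ 0` are 1-Lipschitz. -/
theorem LocallyAbsolutelyContinuous.cutoffSq {f : ℝ → ℝ} (hf : LocallyAbsolutelyContinuous f)
    (m : ℕ) : LocallyAbsolutelyContinuous fun x => cutoffSq m (f x) := by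
  have hv : LocallyAbsolutelyContinuous fun x => excess (f x) := hf.of_dist_le fun x y => by
    rw [Real.dist_eq, Real.dist_eq]
    refine (abs_max_sub_max_le_abs _ _ _).trans_eq ?_
    congr 1; ring
  have hr : LocallyAbsolutelyContinuous fun x => excessRatio (f x) := hv.of_dist_le fun x y => by
    have h1 := excess_nonneg (f x)
    have h2 := excess_nonneg (f y)
    rw [Real.dist_eq, Real.dist_eq, excessRatio, excessRatio,
      div_sub_div _ _ (by linarith) (by linarith), abs_div]
    refine div_le_of_le_mul₀ (abs_nonneg _) (abs_nonneg _) ?_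
    have e : excess (f x) * (1 + excess (f y)) - (1 + excess (f x)) * excess (f y) =
      excess (f x) - excess (f y) := by ring
    rw [e]
    refine le_mul_of_one_le_right (abs_nonneg _) ?_
    rw [abs_of_nonneg (by positivity)]
    nlinarith [mul_nonneg h1 h2]
  exact (hv.pow 2).mul (hr.pow (m + 1))

/-- Differentiation lowers the power of `r` by one only; the surviving `r ^ m` is what the
Young-type inequality needs. -/
theorem abs_deriv_cutoffSq_le {f : ℝ → ℝ} {x : ℝ} (hf : DifferentiableAt ℝ f x) (m : ℕ) :
    |deriv (fun y => cutoffSq m (f y)) x| ≤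
      excess (f x) ^ 2 * ((m + 3) * excessRatio (f x) ^ m * |deriv f x / f x|) := by
  rcases le_or_gt (f x) 1 with h | h
  · have h0 : cutoffSq m (f x) = 0 := by simp [cutoffSq, excess_of_le h]
    -- Where `f ≤ 1` the composite attains its minimum `0`, so its derivative vanishes even at the
    -- kink of `excess`.
    have hmin : IsLocalMin (fun y => cutoffSq m (f y)) x :=
      Filter.Eventually.of_forall fun y => by
        simp only [h0]
        exact cutoffSq_nonneg m (f y)
    rw [hmin.deriv_eq_zero, excess_of_le h]
    simp
  · have hev : (fun y => cutoffSq m (f y)) =ᶠ[nhds x]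
        fun y => (f y - 1) ^ 2 * ((f y - 1) / f y) ^ (m + 1) := by
      filter_upwards [hf.continuousAt.eventually_const_lt h] with y hy
      rw [cutoffSq, excessRatio, excess_of_one_le hy.le]
      simp
    have hr : excessRatio (f x) = (f x - 1) / f x := by
      rw [excessRatio, excess_of_one_le h.le]; simp
    have hx0 : 0 < f x := by linarith
    have hd := hf.hasDerivAt
    have hder := ((hd.sub_const 1).fun_pow 2).fun_mul
      ((((hd.sub_const 1).fun_div hd hx0.ne')).fun_pow (m + 1))
    rw [hev.deriv_eq, hder.deriv, excess_of_one_le h.le, hr]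
    have hq0 : 0 ≤ (f x - 1) / f x := div_nonneg (by linarith) hx0.le
    have e : (2 : ℕ) * (f x - 1) ^ (2 - 1) * deriv f x * ((f x - 1) / f x) ^ (m + 1) +
        (f x - 1) ^ 2 * (((m + 1 : ℕ) : ℝ) * ((f x - 1) / f x) ^ (m + 1 - 1) *
          ((deriv f x * f x - (f x - 1) * deriv f x) / f x ^ 2)) =
        (f x - 1) ^ 2 * ((2 + (m + 1) / f x) * ((f x - 1) / f x) ^ m * (deriv f x / f x)) := by
      rw [pow_succ ((f x - 1) / f x) m, Nat.add_sub_cancel]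
      push_cast
      field_simp
      ring
    rw [e, abs_mul, abs_of_nonneg (sq_nonneg _), abs_mul, abs_mul, abs_of_nonneg (pow_nonneg hq0 m),
      abs_of_nonneg (by positivity : 0 ≤ 2 + ((m : ℝ) + 1) / f x)]
    have h2 : ((m : ℝ) + 1) / f x ≤ m + 1 := div_le_self (by positivity) h.le
    have h3 : 2 + ((m : ℝ) + 1) / f x ≤ m + 3 := by linarith
    exact mul_le_mul_of_nonneg_left (mul_le_mul_of_nonneg_right
      (mul_le_mul_of_nonneg_right h3 (pow_nonneg hq0 m)) (abs_nonneg _)) (sq_nonneg _)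

/-! ### Weighted estimates on the line. -/

/-- A nonnegative integrable locally absolutely continuous function is bounded by the integral
of any bound for its derivative. -/
theorem apply_le_integral_of_abs_deriv_le {k Q : ℝ → ℝ} (hk : LocallyAbsolutelyContinuous k)
    (hki : Integrable k) (hQ : Integrable Q) (h : ∀ᵐ x, |deriv k x| ≤ Q x) (x : ℝ) :
    k x ≤ ∫ y, Q y := by
  by_contra! hlt
  have hQ0 : 0 ≤ᵐ[volume] Q := by
    filter_upwards [h] with y hy
    exact (abs_nonneg _).trans hy
  -- The lower bound is a positive constant, which is not integrable on `ℝ`.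
  have hlow : ∀ y, k x - ∫ t, Q t ≤ k y := by
    intro y
    have h1 : ‖∫ t in y..x, deriv k t‖ ≤ ∫ t, Q t :=
      calc _ ≤ ∫ t in uIoc y x, ‖deriv k t‖ :=
            intervalIntegral.norm_integral_le_integral_norm_uIoc
        _ ≤ ∫ t in uIoc y x, Q t :=
            integral_mono_ae (intervalIntegrable_iff.1 (hk y x).intervalIntegrable_deriv).norm
              hQ.integrableOn (ae_restrict_of_ae h)
        _ ≤ ∫ t, Q t := setIntegral_le_integral hQ hQ0
    rw [(hk y x).integral_deriv_eq_sub] at h1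
    linarith [le_abs_self (k x - k y), Real.norm_eq_abs (k x - k y)]
  have hconst : Integrable fun _ : ℝ => k x - ∫ t, Q t := by
    refine hki.mono' aestronglyMeasurable_const (Filter.Eventually.of_forall fun y => ?_)
    rw [Real.norm_of_nonneg (by linarith)]
    exact hlow y
  rw [integrable_const_iff] at hconst
  rcases hconst with h0 | h0
  · linarith
  · exact absurd h0.measure_univ_lt_top (by simp)

theorem hasDerivAt_exp_neg {Φ : ℝ → ℝ} (hd : Differentiable ℝ Φ) (x : ℝ) :
    HasDerivAt (fun x => Real.exp (-Φ x)) (-(deriv Φ x * Real.exp (-Φ x))) x := by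
  convert! (hd x).hasDerivAt.fun_neg.exp using 1
  ring

/-- Weighted integration by parts: a Young-type bound on the derivative of `G` controls the
moment `∫ G x Φ' exp (-Φ)`. -/
theorem integral_mul_deriv_mul_exp_neg_le {Φ G u g : ℝ → ℝ} {C : ℝ} (hΦ : ContDiff ℝ 1 Φ)
    (hP : ∀ x, 0 ≤ x * deriv Φ x) (hC : 0 ≤ C) (hG : LocallyAbsolutelyContinuous G)
    (hG0 : ∀ x, 0 ≤ G x) (hGu : ∀ x, G x ≤ u x) (hg0 : ∀ x, 0 ≤ g x)
    (hu : Integrable fun x => u x * Real.exp (-Φ x))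
    (hg : Integrable fun x => g x * Real.exp (-Φ x))
    (hY : ∀ᵐ x, |deriv G x| * |x| ≤ g x + C * u x + G x * (x * deriv Φ x) / 2) :
    (Integrable fun x => G x * (x * deriv Φ x) * Real.exp (-Φ x)) ∧
      ∫ x, G x * (x * deriv Φ x) * Real.exp (-Φ x) ≤
        2 * ((∫ x, g x * Real.exp (-Φ x)) + (C + 1) * ∫ x, u x * Real.exp (-Φ x)) := by
  have hd : Differentiable ℝ Φ := hΦ.differentiable (by norm_num)
  have hcd : Continuous (deriv Φ) := hΦ.continuous_deriv (by norm_num)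
  have hcΦ := hd.continuous
  have hcG := hG.continuous
  set q : ℝ → ℝ := fun x => g x * Real.exp (-Φ x) + (C + 1) * (u x * Real.exp (-Φ x)) with hq
  set p : ℝ → ℝ := fun x => G x * (x * deriv Φ x) * Real.exp (-Φ x) with hp
  have hqi : Integrable q := hg.add (hu.const_mul _)
  have hpc : Continuous p := by rw [hp]; fun_prop
  have hp0 : ∀ x, 0 ≤ p x := fun x =>
    mul_nonneg (mul_nonneg (hG0 x) (hP x)) (Real.exp_pos _).le
  have hq0 : ∀ x, 0 ≤ q x := fun x => by
    have := hg0 x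
    have := (hG0 x).trans (hGu x)
    positivity
  have hqint : ∫ x, q x = (∫ x, g x * Real.exp (-Φ x)) + (C + 1) * ∫ x, u x * Real.exp (-Φ x) := by
    rw [hq, integral_add hg (hu.const_mul _), integral_const_mul]
  have hF : LocallyAbsolutelyContinuous fun x => G x * (x * Real.exp (-Φ x)) :=
    hG.mul (.of_contDiff (contDiff_id.mul hΦ.neg.exp))
  have hder : ∀ᵐ x, deriv (fun x => G x * (x * Real.exp (-Φ x))) x ≤ q x - p x / 2 := by
    filter_upwards [hY, hG.ae_differentiableAt] with x hx hdx
    have h1 := hdx.hasDerivAt.fun_mul ((hasDerivAt_id' x).fun_mul (hasDerivAt_exp_neg hd x))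
    rw [h1.deriv]
    have h2 : deriv G x * x ≤ |deriv G x| * |x| := by rw [← abs_mul]; exact le_abs_self _
    have h3 : deriv G x * x + G x - G x * (x * deriv Φ x) ≤
        g x + (C + 1) * u x - G x * (x * deriv Φ x) / 2 := by linarith [hGu x]
    have h4 := mul_le_mul_of_nonneg_right h3 (Real.exp_pos (-Φ x)).le
    simp only [hq, hp]
    linarith
  -- The boundary contributions at `±R` have the favourable sign, so no decay is needed and the
  -- bound is uniform in `R`.
  have hbound : ∀ R : ℝ, 0 ≤ R → ∫ x in -R..R, p x ≤ 2 * ∫ x, q x := by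
    intro R hR
    have hRR : -R ≤ R := by linarith
    have h1 := intervalIntegral.integral_mono_ae hRR (hF (-R) R).intervalIntegrable_deriv
      (hqi.intervalIntegrable.sub ((hpc.intervalIntegrable (-R) R).div_const 2)) hder
    rw [(hF (-R) R).integral_deriv_eq_sub,
      intervalIntegral.integral_sub hqi.intervalIntegrable
        ((hpc.intervalIntegrable (-R) R).div_const 2),
      intervalIntegral.integral_div] at h1
    have h2 : ∫ x in -R..R, q x ≤ ∫ x, q x := by
      rw [intervalIntegral.integral_of_le hRR]
      exact setIntegral_le_integral hqi (Filter.Eventually.of_forall hq0)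
    have h3 : 0 ≤ G R * (R * Real.exp (-Φ R)) := by have := hG0 R; positivity
    have h4 : 0 ≤ G (-R) * (R * Real.exp (-Φ (-R))) := by have := hG0 (-R); positivity
    linarith
  have hbot : Filter.Tendsto (fun n : ℕ => -(n : ℝ)) Filter.atTop Filter.atBot :=
    Filter.tendsto_neg_atTop_atBot.comp tendsto_natCast_atTop_atTop
  have hpi : Integrable p := by
    refine integrable_of_intervalIntegral_norm_bounded (l := Filter.atTop) (2 * ∫ x, q x)
      (fun n : ℕ => hpc.integrableOn_Ioc) hbot tendsto_natCast_atTop_atTop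
      (Filter.Eventually.of_forall fun n => ?_)
    simp only [Real.norm_of_nonneg (hp0 _)]
    exact hbound n n.cast_nonneg
  refine ⟨hpi, ?_⟩
  rw [← hqint]
  exact le_of_tendsto' (intervalIntegral_tendsto_integral hpi hbot tendsto_natCast_atTop_atTop)
    fun n => hbound n n.cast_nonneg

/-- The derivative of `G exp (-Φ)` is dominated by an integrable function, so this product is
bounded by its integral. -/
theorem mul_exp_neg_le {Φ G u g : ℝ → ℝ} {C c : ℝ} (hΦ : ContDiff ℝ 1 Φ)
    (hP : ∀ x, |deriv Φ x| ≤ C + x * deriv Φ x) (hC : 0 ≤ C)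
    (hG : LocallyAbsolutelyContinuous G)
    (hG0 : ∀ x, 0 ≤ G x) (hGu : ∀ x, G x ≤ u x)
    (hu : Integrable fun x => u x * Real.exp (-Φ x))
    (hg : Integrable fun x => g x * Real.exp (-Φ x))
    (hp : Integrable fun x => G x * (x * deriv Φ x) * Real.exp (-Φ x))
    (hY : ∀ᵐ x, |deriv G x| ≤ c * (u x + g x)) (x : ℝ) :
    G x * Real.exp (-Φ x) ≤ c * (∫ x, g x * Real.exp (-Φ x)) +
      (c + C) * (∫ x, u x * Real.exp (-Φ x)) +
        ∫ x, G x * (x * deriv Φ x) * Real.exp (-Φ x) := by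
  have hd : Differentiable ℝ Φ := hΦ.differentiable (by norm_num)
  have hcΦ := hd.continuous
  have hcG := hG.continuous
  have hgu : Integrable fun x =>
      c * (g x * Real.exp (-Φ x)) + (c + C) * (u x * Real.exp (-Φ x)) :=
    (hg.const_mul _).add (hu.const_mul _)
  rw [← integral_const_mul, ← integral_const_mul,
    ← integral_add (hg.const_mul _) (hu.const_mul _), ← integral_add hgu hp]
  refine apply_le_integral_of_abs_deriv_le (k := fun x => G x * Real.exp (-Φ x))
    (hG.mul (.of_contDiff hΦ.neg.exp)) ?_
    (hgu.add hp) ?_ x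
  · refine hu.mono' (by fun_prop) (Filter.Eventually.of_forall fun y => ?_)
    rw [Real.norm_of_nonneg (mul_nonneg (hG0 y) (Real.exp_pos _).le)]
    exact mul_le_mul_of_nonneg_right (hGu y) (Real.exp_pos _).le
  · filter_upwards [hY, hG.ae_differentiableAt] with y hy hdy
    rw [(hdy.hasDerivAt.fun_mul (hasDerivAt_exp_neg hd y)).deriv]
    have e : deriv G y * Real.exp (-Φ y) + G y * -(deriv Φ y * Real.exp (-Φ y)) =
        (deriv G y - G y * deriv Φ y) * Real.exp (-Φ y) := by ring
    rw [e, abs_mul, abs_of_pos (Real.exp_pos _)]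
    have h1 : |deriv G y - G y * deriv Φ y| ≤ |deriv G y| + G y * |deriv Φ y| := by
      refine (abs_sub _ _).trans_eq ?_
      rw [abs_mul, abs_of_nonneg (hG0 y)]
    have h2 := mul_le_mul_of_nonneg_left (hP y) (hG0 y)
    have h3 := mul_le_mul_of_nonneg_left (hGu y) hC
    have h4 : |deriv G y - G y * deriv Φ y| ≤
        c * g y + (c + C) * u y + G y * (y * deriv Φ y) := by linarith
    have h5 := mul_le_mul_of_nonneg_right h4 (Real.exp_pos (-Φ y)).le
    simp only [Pi.add_apply]
    linarith

/-- If `F ≤ N G` where `F ≥ 1` and `G exp (-Φ) ≤ S`, then `F log F exp (-Φ)` is controlled by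
the mass and the `x Φ'`-moment of `G exp (-Φ)`. -/
theorem mul_log_mul_exp_neg_le {F G N S Z C φ P : ℝ} (hF : 1 ≤ F) (hN : 1 ≤ N) (hG : 0 ≤ G)
    (hFG : F ≤ N * G) (hS : G * Real.exp (-φ) ≤ S) (hZ : 0 < Z) (hφ : |φ| ≤ C + P) :
    F * Real.log F * Real.exp (-φ) ≤
      N * ((Real.log N + |Real.log Z| + C) * (G * Real.exp (-φ)) +
        S / Z * (G * Real.exp (-φ)) + G * P * Real.exp (-φ)) := by
  have hG' : 0 < G := by
    rcases hG.eq_or_lt with h | h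
    · rw [← h] at hFG; linarith
    · exact h
  have hexp := Real.exp_pos (-φ)
  have hS0 : 0 < S := (mul_pos hG' hexp).trans_le hS
  have h1 : Real.log F ≤ Real.log N + Real.log G := by
    rw [← Real.log_mul (by linarith) hG'.ne']
    exact Real.log_le_log (by linarith) hFG
  have h2 : Real.log G - φ ≤ Real.log S := by
    have := Real.log_le_log (mul_pos hG' hexp) hS
    rwa [Real.log_mul hG'.ne' hexp.ne', Real.log_exp] at this
  -- The tangent-line bound makes the estimate linear in `S`, at the scale `Z`.
  have h3 : Real.log S ≤ S / Z + Real.log Z := by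
    have := Real.log_le_sub_one_of_pos (div_pos hS0 hZ)
    rw [Real.log_div hS0.ne' hZ.ne'] at this
    linarith
  have h4 : Real.log F ≤ Real.log N + |Real.log Z| + C + S / Z + P := by
    linarith [le_abs_self φ, le_abs_self (Real.log Z)]
  have h5 : F * Real.log F ≤ N * G * (Real.log N + |Real.log Z| + C + S / Z + P) :=
    mul_le_mul hFG h4 (Real.log_nonneg hF) (by positivity)
  have h6 := mul_le_mul_of_nonneg_right h5 hexp.le
  linarith

/-- On a set where `1 ≤ F ≤ N G`, the integral of `F log F exp (-Φ)` is controlled by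
`∫ u exp (-Φ)` and `∫ g exp (-Φ)`, where `u` dominates `G` and `g` is the energy. -/
theorem integral_indicator_mul_log_le {Φ F G u g : ℝ → ℝ} {C c N Z : ℝ} {s : Set ℝ}
    (hΦ : ContDiff ℝ 1 Φ) (hP0 : ∀ x, 0 ≤ x * deriv Φ x)
    (hP : ∀ x, |Φ x| ≤ C + x * deriv Φ x) (hP' : ∀ x, |deriv Φ x| ≤ C + x * deriv Φ x)
    (hC : 0 ≤ C) (hN : 1 ≤ N) (hZ : 0 < Z)
    (hG : LocallyAbsolutelyContinuous G)
    (hG0 : ∀ x, 0 ≤ G x) (hGu : ∀ x, G x ≤ u x) (hg0 : ∀ x, 0 ≤ g x)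
    (hu : Integrable fun x => u x * Real.exp (-Φ x))
    (hg : Integrable fun x => g x * Real.exp (-Φ x))
    (hY : ∀ᵐ x, |deriv G x| * |x| ≤ g x + C * u x + G x * (x * deriv Φ x) / 2)
    (hY' : ∀ᵐ x, |deriv G x| ≤ c * (u x + g x))
    (huZ : ∫ x, u x * Real.exp (-Φ x) ≤ Z)
    (hs : MeasurableSet s) (hFc : Measurable F) (hF1 : ∀ x ∈ s, 1 ≤ F x)
    (hFG : ∀ x ∈ s, F x ≤ N * G x) :
    (Integrable fun x => s.indicator (fun x => F x * Real.log (F x)) x * Real.exp (-Φ x)) ∧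
      ∫ x, s.indicator (fun x => F x * Real.log (F x)) x * Real.exp (-Φ x) ≤
        N * (Real.log N + |Real.log Z| + c + 6 * C + 4) * (∫ x, u x * Real.exp (-Φ x)) +
          N * (c + 4) * ∫ x, g x * Real.exp (-Φ x) := by
  have hd : Differentiable ℝ Φ := hΦ.differentiable (by norm_num)
  have hcΦ := hd.continuous
  have hcG := hG.continuous
  obtain ⟨hpi, hple⟩ := integral_mul_deriv_mul_exp_neg_le hΦ hP0 hC hG hG0 hGu hg0 hu hg hY
  have hsup := mul_exp_neg_le hΦ hP' hC hG hG0 hGu hu hg hpi hY'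
  set V := ∫ x, u x * Real.exp (-Φ x) with hV
  set I := ∫ x, g x * Real.exp (-Φ x) with hI
  set T := ∫ x, G x * (x * deriv Φ x) * Real.exp (-Φ x) with hT
  set S := c * I + (c + C) * V + T with hS
  have hS0 : 0 ≤ S := (mul_nonneg (hG0 0) (Real.exp_pos _).le).trans (hsup 0)
  have hki : Integrable fun x => G x * Real.exp (-Φ x) := by
    refine hu.mono' (by fun_prop) (Filter.Eventually.of_forall fun y => ?_)
    rw [Real.norm_of_nonneg (mul_nonneg (hG0 y) (Real.exp_pos _).le)]
    exact mul_le_mul_of_nonneg_right (hGu y) (Real.exp_pos _).le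
  set K := ∫ x, G x * Real.exp (-Φ x) with hK
  have hKV : K ≤ V := integral_mono hki hu fun x =>
    mul_le_mul_of_nonneg_right (hGu x) (Real.exp_pos _).le
  have hlogN : 0 ≤ Real.log N := Real.log_nonneg hN
  set dom : ℝ → ℝ := fun x =>
    N * ((Real.log N + |Real.log Z| + C) * (G x * Real.exp (-Φ x)) +
        S / Z * (G x * Real.exp (-Φ x)) + G x * (x * deriv Φ x) * Real.exp (-Φ x)) with hdom
  have hkk : Integrable fun x => (Real.log N + |Real.log Z| + C) * (G x * Real.exp (-Φ x)) +
      S / Z * (G x * Real.exp (-Φ x)) := (hki.const_mul _).add (hki.const_mul _)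
  have hdomi : Integrable dom := (hkk.add hpi).const_mul _
  have hdom0 : ∀ x, 0 ≤ dom x := fun x => by
    have h1 := hG0 x
    have h2 := hP0 x
    positivity
  have hle : ∀ x, s.indicator (fun x => F x * Real.log (F x)) x * Real.exp (-Φ x) ≤ dom x := by
    intro x
    by_cases hx : x ∈ s
    · rw [indicator_of_mem hx]
      exact mul_log_mul_exp_neg_le (hF1 x hx) hN (hG0 x) (hFG x hx) (hsup x) hZ (hP x)
    · rw [indicator_of_notMem hx, zero_mul]
      exact hdom0 x
  have hnn : ∀ x, 0 ≤ s.indicator (fun x => F x * Real.log (F x)) x * Real.exp (-Φ x) :=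
    fun x => mul_nonneg (indicator_nonneg (fun y hy =>
      mul_nonneg (by linarith [hF1 y hy]) (Real.log_nonneg (hF1 y hy))) x) (Real.exp_pos _).le
  have hint : Integrable fun x =>
      s.indicator (fun x => F x * Real.log (F x)) x * Real.exp (-Φ x) := by
    refine hdomi.mono' ?_ (Filter.Eventually.of_forall fun x => ?_)
    · exact (((hFc.mul hFc.log).indicator hs).mul (by fun_prop)).aestronglyMeasurable
    · rw [Real.norm_of_nonneg (hnn x)]
      exact hle x
  refine ⟨hint, (integral_mono hint hdomi hle).trans ?_⟩
  have hdomint : ∫ x, dom x = N * ((Real.log N + |Real.log Z| + C) * K + S / Z * K + T) := by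
    rw [hdom, integral_const_mul, integral_add hkk hpi,
      integral_add (hki.const_mul _) (hki.const_mul _), integral_const_mul, integral_const_mul]
  rw [hdomint]
  have h1 : (Real.log N + |Real.log Z| + C) * K ≤ (Real.log N + |Real.log Z| + C) * V :=
    mul_le_mul_of_nonneg_left hKV (by positivity)
  -- Here the normalization enters: `K ≤ V ≤ Z` turns the quadratic term into a linear one.
  have h2 : S / Z * K ≤ S := by
    rw [div_mul_eq_mul_div]
    exact div_le_of_le_mul₀ hZ.le hS0 (mul_le_mul_of_nonneg_left (hKV.trans huZ) hS0)
  have h3 : (Real.log N + |Real.log Z| + C) * K + S / Z * K + T ≤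
      (Real.log N + |Real.log Z| + c + 6 * C + 4) * V + (c + 4) * I := by
    rw [hS] at h2 ⊢
    linarith
  have h4 := mul_le_mul_of_nonneg_left h3 (by linarith : 0 ≤ N)
  linarith

/-! ### Passage to `muPhi` and the entropy inequality. -/

theorem integrable_exp_neg {Φ : ℝ → ℝ} (hd : Differentiable ℝ Φ)
    (he : ∀ x, Φ (-x) = Φ x) (hH : GrowthHyp Φ) : Integrable fun x => Real.exp (-Φ x) := by
  by_contra h
  have := isProbabilityMeasure_muPhi hd he hH
  have h0 : muPhi Φ = 0 := tilted_of_not_integrable h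
  exact IsProbabilityMeasure.ne_zero (muPhi Φ) h0

theorem integrable_muPhi_iff {Φ : ℝ → ℝ} (hi : Integrable fun x => Real.exp (-Φ x)) (g : ℝ → ℝ) :
    Integrable g (muPhi Φ) ↔ Integrable fun x => g x * Real.exp (-Φ x) := by
  rw [muPhi, integrable_tilted_iff hi]
  simp only [smul_eq_mul, mul_comm]

theorem integral_muPhi (Φ g : ℝ → ℝ) :
    ∫ x, g x ∂(muPhi Φ) = (∫ x, Real.exp (-Φ x))⁻¹ * ∫ x, g x * Real.exp (-Φ x) := by
  rw [muPhi, integral_tilted, ← integral_const_mul]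
  congr 1
  ext x
  rw [smul_eq_mul]
  ring

/-- From `log t ≤ t - 1`, with `2 t² (t - 1) - (t² - 1) = (t - 1)² (2 t + 1)` and `2 t + 1 ≤ 5`. -/
theorem sq_mul_log_sq_le {t : ℝ} (h0 : 0 ≤ t) (h2 : t < 2) :
    t ^ 2 * Real.log (t ^ 2) ≤ t ^ 2 - 1 + 5 * (t - 1) ^ 2 := by
  rcases h0.eq_or_lt with h | h
  · rw [← h]; norm_num
  · rw [Real.log_pow]
    have h1 := mul_le_mul_of_nonneg_left (Real.log_le_sub_one_of_pos h) (sq_nonneg t)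
    push_cast
    nlinarith [mul_nonneg (sq_nonneg (t - 1)) (sub_nonneg.2 h2.le)]

/-- For `f ≥ 0` normalized in `L²`, `∫ (f - 1)²` is at most twice the variance. -/
theorem integral_sub_one_sq_le_two_mul_variance {Ω : Type*} [MeasurableSpace Ω] {μ : Measure Ω}
    [IsProbabilityMeasure μ] {f : Ω → ℝ} (hf : MemLp f 2 μ) (h0 : ∀ x, 0 ≤ f x)
    (h1 : ∫ x, f x ^ 2 ∂μ = 1) :
    Integrable (fun x => (f x - 1) ^ 2) μ ∧ ∫ x, (f x - 1) ^ 2 ∂μ ≤ 2 * variance f μ := by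
  have hfi : Integrable f μ := hf.integrable (by norm_num)
  have hsub : MemLp (fun x => f x - 1) 2 μ := hf.sub (memLp_const 1)
  refine ⟨hsub.integrable_sq, ?_⟩
  have hv := variance_eq_sub hf
  have hv0 := variance_nonneg f μ
  have hm0 : 0 ≤ ∫ x, f x ∂μ := integral_nonneg h0
  have e : ∫ x, (f x - 1) ^ 2 ∂μ = 2 - 2 * ∫ x, f x ∂μ := by
    have e1 : ∀ x, (f x - 1) ^ 2 = f x ^ 2 - (2 * f x - 1) := fun x => by ring
    have hi2 : Integrable (fun x => 2 * f x - 1) μ :=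
      (hfi.const_mul 2).sub (integrable_const 1)
    simp only [e1]
    rw [integral_sub hf.integrable_sq hi2, integral_sub (hfi.const_mul 2) (integrable_const 1),
      integral_const_mul, h1]
    simp
    ring
  have h2 : μ[f ^ 2] = 1 := h1
  rw [h2] at hv
  rw [e, hv]
  -- With `a = ∫ f`, this is `2 - 2 a ≤ 2 (1 - a²)`; nonnegativity of `f` and of the variance give
  -- `0 ≤ a ≤ 1`.
  nlinarith

theorem mainTheorem1 (Φ : ℝ → ℝ) (hC2 : ContDiff ℝ 2 Φ) (hconv : ConvexOn ℝ Set.univ Φ)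
    (heven : ∀ x, Φ (-x) = Φ x) (hH : GrowthHyp Φ) :
    ∃ A A' B D κ : ℝ, 0 ≤ A ∧ 0 ≤ A' ∧ 0 ≤ B ∧ 0 ≤ D ∧ 0 ≤ κ ∧
      ∀ f : ℝ → ℝ, LocallyAbsolutelyContinuous f → (∀ x, 0 ≤ f x) →
        ∫ x, f x ^ 2 ∂(muPhi Φ) = 1 →
        -- otherwise the integral on the right-hand side is `+∞` and the bound is trivial
        IntegrableOn (fun x => modH Φ B D (deriv f x / f x) * f x ^ 2)
          {x | κ ≤ f x ^ 2} (muPhi Φ) →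
        -- the entropy is finite
        Integrable (fun x => f x ^ 2 * Real.log (f x ^ 2)) (muPhi Φ) ∧
        ent (muPhi Φ) (fun x => f x ^ 2) ≤
          A * variance f (muPhi Φ) +
            A' * ∫ x in {x | κ ≤ f x ^ 2},
              modH Φ B D (deriv f x / f x) * f x ^ 2 ∂(muPhi Φ) := by
  have hC1 : ContDiff ℝ 1 Φ := hC2.of_le (by norm_num)
  have hd : Differentiable ℝ Φ := hC1.differentiable (by norm_num)
  have hP := hconv.mul_deriv_nonneg_of_even hd heven
  have hprob := isProbabilityMeasure_muPhi hd heven hH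
  have hwi := integrable_exp_neg hd heven hH
  obtain ⟨m, C, hC, hΦ, hΦ', hyoung⟩ := hH.exists_young hC1 hconv heven
  have hB2 : (2 : ℝ) ≤ 2 * (m + 3) := by linarith [(Nat.cast_nonneg m : (0 : ℝ) ≤ m)]
  have hmod := abs_le_one_add_modH hd heven hH hB2
  set H := modH Φ (2 * (m + 3)) |Φ 1| with hHdef
  set Z := ∫ x, Real.exp (-Φ x) with hZdef
  have hZ : 0 < Z := integral_exp_pos hwi
  set N : ℝ := 2 ^ (m + 3) with hN
  have hN1 : 1 ≤ N := one_le_pow₀ (by norm_num)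
  have hlogN : 0 ≤ Real.log N := Real.log_nonneg hN1
  set K₁ : ℝ := N * (Real.log N + |Real.log Z| + (m + 3) + 6 * C + 4) with hK₁
  set K₂ : ℝ := N * ((m + 3) + 4) with hK₂
  have hK₁0 : 0 ≤ K₁ := by positivity
  have hK₂0 : 0 ≤ K₂ := by positivity
  -- In `A`, the `5` comes from `{f < 2}`, `K₁` from `{f ≥ 2}`, and the factor `2` from comparing `∫
  -- (f - 1)²` with the variance. The threshold `κ = 1` is where `excess` starts.
  refine ⟨2 * (5 + K₁), K₂, 2 * (m + 3), |Φ 1|, 1, by positivity, hK₂0, by positivity,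
    abs_nonneg _, zero_le_one, fun f hf hf0 hf1 hfH => ?_⟩
  have hfc := hf.continuous
  have hset : MeasurableSet {x | 1 ≤ f x ^ 2} :=
    (isClosed_le continuous_const (hfc.pow 2)).measurableSet
  -- A non-integrable `f²` would have integral `0` by convention, not `1`.
  have hf2 : Integrable (fun x => f x ^ 2) (muPhi Φ) := by
    by_contra h
    rw [integral_undef h] at hf1
    exact zero_ne_one hf1
  have hL2 : MemLp f 2 (muPhi Φ) :=
    (memLp_two_iff_integrable_sq hfc.aestronglyMeasurable).2 hf2
  obtain ⟨hvi, hvar⟩ := integral_sub_one_sq_le_two_mul_variance hL2 hf0 hf1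
  set g : ℝ → ℝ := {x | 1 ≤ f x ^ 2}.indicator fun x => H (deriv f x / f x) * f x ^ 2 with hg
  have hg0 : ∀ x, 0 ≤ g x := fun x =>
    indicator_nonneg (fun y _ => mul_nonneg (hmod _).1 (sq_nonneg _)) x
  have hgi : Integrable g (muPhi Φ) := (integrable_indicator_iff hset).2 hfH
  have hgint : ∫ x in {x | 1 ≤ f x ^ 2}, H (deriv f x / f x) * f x ^ 2 ∂(muPhi Φ) =
      ∫ x, g x ∂(muPhi Φ) := (integral_indicator hset).symm
  have hvH : ∀ x, excess (f x) ^ 2 * H (deriv f x / f x) ≤ g x := by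
    intro x
    rcases le_total (f x) 1 with h | h
    · rw [excess_of_le h]; simpa using hg0 x
    · have hx : x ∈ {x | 1 ≤ f x ^ 2} := one_le_pow₀ h
      rw [hg, indicator_of_mem hx, excess_of_one_le h, mul_comm]
      exact mul_le_mul_of_nonneg_left (pow_le_pow_left₀ (by linarith) (by linarith) _) (hmod _).1
  have hvle : ∀ x, excess (f x) ^ 2 ≤ (f x - 1) ^ 2 := by
    intro x
    rcases le_total (f x) 1 with h | h
    · rw [excess_of_le h]; simpa using sq_nonneg (f x - 1)
    · rw [excess_of_one_le h]
  have hvf : ∀ x, excess (f x) ^ 2 ≤ f x ^ 2 := by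
    intro x
    exact pow_le_pow_left₀ (excess_nonneg _) (max_le (by linarith) (hf0 x)) 2
  have hec : Continuous fun x => excess (f x) := (hfc.sub continuous_const).max continuous_const
  have hui : Integrable (fun x => excess (f x) ^ 2) (muPhi Φ) :=
    hf2.mono' (hec.pow 2).aestronglyMeasurable (Filter.Eventually.of_forall fun x => by
      rw [Real.norm_of_nonneg (sq_nonneg _)]; exact hvf x)
  have huZ : ∫ x, excess (f x) ^ 2 * Real.exp (-Φ x) ≤ Z := by
    have h1 : ∫ x, excess (f x) ^ 2 ∂(muPhi Φ) ≤ 1 := hf1 ▸ integral_mono hui hf2 hvf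
    rw [integral_muPhi] at h1
    rwa [inv_mul_le_iff₀ hZ, mul_one] at h1
  have hder : ∀ᵐ x, |deriv (fun y => cutoffSq m (f y)) x| ≤
      excess (f x) ^ 2 * ((m + 3) * excessRatio (f x) ^ m * |deriv f x / f x|) := by
    filter_upwards [hf.ae_differentiableAt] with x hx
    exact abs_deriv_cutoffSq_le hx m
  have hY : ∀ᵐ x, |deriv (fun y => cutoffSq m (f y)) x| * |x| ≤
      g x + C * excess (f x) ^ 2 + cutoffSq m (f x) * (x * deriv Φ x) / 2 := by
    filter_upwards [hder] with x hx
    have h1 := hyoung (deriv f x / f x) x _ (excessRatio_nonneg (f x)) (excessRatio_le_one (f x))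
    have h2 := mul_le_mul_of_nonneg_right hx (abs_nonneg x)
    have h3 := mul_le_mul_of_nonneg_left h1 (sq_nonneg (excess (f x)))
    have h4 := hvH x
    rw [cutoffSq]
    linarith
  have hY' : ∀ᵐ x, |deriv (fun y => cutoffSq m (f y)) x| ≤
      (m + 3) * (excess (f x) ^ 2 + g x) := by
    filter_upwards [hder] with x hx
    refine hx.trans ?_
    have h1 : (m + 3) * excessRatio (f x) ^ m * |deriv f x / f x| ≤
        (m + 3) * (1 + H (deriv f x / f x)) :=
      mul_le_mul (mul_le_of_le_one_right (by positivity)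
        (pow_le_one₀ (excessRatio_nonneg _) (excessRatio_le_one _)))
        (hmod _).2 (abs_nonneg _) (by positivity)
    have h2 := mul_le_mul_of_nonneg_left h1 (sq_nonneg (excess (f x)))
    have h3 := mul_le_mul_of_nonneg_left (hvH x) (by positivity : (0 : ℝ) ≤ m + 3)
    linarith
  obtain ⟨hEi, hEle⟩ := integral_indicator_mul_log_le (F := fun x => f x ^ 2)
    (s := {x | 2 ≤ f x}) hC1 hP hΦ hΦ' hC hN1 hZ
    (hf.cutoffSq m) (fun x => cutoffSq_nonneg m (f x)) (fun x => cutoffSq_le m (f x)) hg0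
    ((integrable_muPhi_iff hwi _).1 hui) ((integrable_muPhi_iff hwi _).1 hgi) hY hY' huZ
    (isClosed_le continuous_const hfc).measurableSet (hfc.pow 2).measurable
    (fun x hx => one_le_pow₀ (one_le_two.trans (show 2 ≤ f x from hx)))
    (fun x hx => sq_le_mul_cutoffSq m hx)
  set E : ℝ → ℝ := {x | 2 ≤ f x}.indicator fun x => f x ^ 2 * Real.log (f x ^ 2) with hE
  have hEμ : Integrable E (muPhi Φ) := (integrable_muPhi_iff hwi _).2 hEi
  have hEint : ∫ x, E x ∂(muPhi Φ) ≤
      K₁ * ∫ x, excess (f x) ^ 2 ∂(muPhi Φ) + K₂ * ∫ x, g x ∂(muPhi Φ) := by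
    rw [integral_muPhi, integral_muPhi Φ g, integral_muPhi Φ fun x => excess (f x) ^ 2]
    have := mul_le_mul_of_nonneg_left hEle (inv_nonneg.2 hZ.le)
    linarith
  have hupper : ∀ x, f x ^ 2 * Real.log (f x ^ 2) ≤
      f x ^ 2 - 1 + 5 * (f x - 1) ^ 2 + E x := by
    intro x
    rcases lt_or_ge (f x) 2 with h | h
    · have : E x = 0 := indicator_of_notMem (s := {x | 2 ≤ f x}) (not_le.2 h) _
      rw [this, add_zero]
      exact sq_mul_log_sq_le (hf0 x) h
    · have : E x = f x ^ 2 * Real.log (f x ^ 2) := indicator_of_mem (s := {x | 2 ≤ f x}) h _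
      rw [this]
      nlinarith [sq_nonneg (f x - 1)]
  have hlower : ∀ x, f x ^ 2 - 1 ≤ f x ^ 2 * Real.log (f x ^ 2) := by
    intro x
    rcases (sq_nonneg (f x)).eq_or_lt with h | h
    · rw [← h]; norm_num
    · have h1 := mul_le_mul_of_nonneg_left (Real.one_sub_inv_le_log_of_pos h) h.le
      rwa [mul_sub, mul_one, mul_inv_cancel₀ h.ne'] at h1
  have hi1 : Integrable (fun x => f x ^ 2 - 1) (muPhi Φ) := hf2.sub (integrable_const 1)
  have hi2 : Integrable (fun x => f x ^ 2 - 1 + 5 * (f x - 1) ^ 2) (muPhi Φ) :=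
    hi1.add (hvi.const_mul 5)
  have hi3 : Integrable (fun x => f x ^ 2 - 1 + 5 * (f x - 1) ^ 2 + E x) (muPhi Φ) :=
    hi2.add hEμ
  -- Entropy is finite because the integrand lies between two integrable functions.
  have hmain : Integrable (fun x => f x ^ 2 * Real.log (f x ^ 2)) (muPhi Φ) :=
    integrable_of_le_of_le
      ((hfc.pow 2).measurable.mul (hfc.pow 2).measurable.log).aestronglyMeasurable
      (Filter.Eventually.of_forall hlower)
      (Filter.Eventually.of_forall hupper) hi1 hi3
  refine ⟨hmain, ?_⟩
  have hle := integral_mono hmain hi3 hupper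
  rw [integral_add hi2 hEμ, integral_add hi1 (hvi.const_mul 5),
    integral_sub hf2 (integrable_const 1), integral_const_mul, hf1] at hle
  simp only [integral_const, probReal_univ, smul_eq_mul, mul_one, sub_self, zero_add] at hle
  have hvv : ∫ x, excess (f x) ^ 2 ∂(muPhi Φ) ≤ ∫ x, (f x - 1) ^ 2 ∂(muPhi Φ) :=
    integral_mono hui hvi hvle
  have h1 := mul_le_mul_of_nonneg_left (hvv.trans hvar) hK₁0
  rw [ent, hf1, Real.log_one, mul_zero, sub_zero, hgint]
  linarith
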